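/- Let $E$ be a real Hausdorff locally convex topological vector space with topological dual $E'$, and let $ck(E)$ be the family of all convex compact non-empty subsets of $E$. For $\varphi\in E'$ and $K\in ck(E)$ write $s(\varphi,K):=\sup\{\varphi(x):x\in K\}$. Let $\Sigma$ be a $\sigma$-algebra on a set $\Omega$ and let $M:\Sigma\to ck(E)$ be a set-valued map such that, for every $\varphi\in E'$, the support map $s(\varphi,M):\Sigma\to\mathbb{R}$, $A\mapsto s(\varphi,M(A))$, is countably additive. Then there is a countably additive map $\nu:\Sigma\to E$ such that $\nu(A)\in\mathrm{ext}(M(A))$ for every $A\in\Sigma$, where $\mathrm{ext}(C)$ denotes the set of extreme points of a convex set $C$. Here a map $\mu$ from $\Sigma$ to $\mathbb{R}$ or $E$ is countably additive if $\mu\left(\bigcup_{n}A_n\right)=\sum_{n}\mu(A_n)$, with (unconditional) convergence of the series in the given topology, for every sequence $(A_n)_n$ of pairwise disjoint sets in $\Sigma$. -/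

import Mathlib

/-- The family `Σ` of measurable subsets of `Ω`, as a type. -/
abbrev SigmaAlg (Ω : Type*) [MeasurableSpace Ω] : Type _ :=
  {A : Set Ω // MeasurableSet A}

/-- A map `μ : Σ → G` is countably additive if, for every sequence `A` of pairwise disjoint members
of `Σ`, the series `∑ₙ μ (A n)` converges (unconditionally: every rearrangement of `A` is again such
a sequence with the same union) and its sum is `μ (⋃ₙ A n)`. -/
def IsCountablyAdditive {Ω : Type*} [MeasurableSpace Ω] {G : Type*} [AddCommMonoid G]
    [TopologicalSpace G] (μ : SigmaAlg Ω → G) : Prop :=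
  ∀ A : ℕ → SigmaAlg Ω, (∀ i j, i ≠ j → Disjoint (A i : Set Ω) (A j : Set Ω)) →
    HasSum (fun n => μ (A n))
      (μ ⟨⋃ n, (A n : Set Ω), MeasurableSet.iUnion fun n => (A n).2⟩)

/-- `s(φ, K) = sup {φ x : x ∈ K}` for `φ` in the topological dual of `E` and `K` a convex compact
non-empty subset of `E` (Mathlib's `ConvexBody E`). -/
noncomputable def supportValue {E : Type*} [AddCommGroup E] [Module ℝ E] [TopologicalSpace E]
    (φ : E →L[ℝ] ℝ) (K : ConvexBody E) : ℝ :=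
  sSup (φ '' (K : Set E))

/-- The supremum defining `s(φ, K)` is always a genuine least upper bound. -/
theorem supportValue_isLUB {E : Type*} [AddCommGroup E] [Module ℝ E] [TopologicalSpace E]
    (φ : E →L[ℝ] ℝ) (K : ConvexBody E) : IsLUB (φ '' (K : Set E)) (supportValue φ K) :=
  isLUB_csSup (K.nonempty.image φ) (K.isCompact.image φ.continuous).bddAbove

/-- The support map `s(φ, M) : Σ → ℝ`, `A ↦ s(φ, M(A))`, of a set-valued map `M`. -/
noncomputable def supportMap {Ω : Type*} [MeasurableSpace Ω] {E : Type*} [AddCommGroup E]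
    [Module ℝ E] [TopologicalSpace E] (φ : E →L[ℝ] ℝ) (M : SigmaAlg Ω → ConvexBody E) :
    SigmaAlg Ω → ℝ :=
  fun A => supportValue φ (M A)

open Filter Topology

/-! ### Additive maps on a σ-algebra -/

/-- A map on a σ-algebra is finitely additive if it is additive on disjoint pairs. -/
def IsFinitelyAdditive {Ω : Type*} [MeasurableSpace Ω] {G : Type*} [Add G]
    (μ : SigmaAlg Ω → G) : Prop :=
  ∀ A B : SigmaAlg Ω, Disjoint A B → μ (A ⊔ B) = μ A + μ B

section Additive

variable {Ω : Type*} [MeasurableSpace Ω]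

theorem SigmaAlg.disjoint_coe {A B : SigmaAlg Ω} :
    Disjoint (A : Set Ω) (B : Set Ω) ↔ Disjoint A B := by
  rw [disjoint_iff, disjoint_iff, Subtype.ext_iff]
  rfl

theorem IsFinitelyAdditive.map_bot {G : Type*} [AddGroup G] {μ : SigmaAlg Ω → G}
    (h : IsFinitelyAdditive μ) : μ ⊥ = 0 := by
  simpa using h ⊥ ⊥ disjoint_bot_left

theorem IsFinitelyAdditive.map_finset_sup {G : Type*} [AddCommGroup G] {μ : SigmaAlg Ω → G}
    (h : IsFinitelyAdditive μ) {ι : Type*} {A : ι → SigmaAlg Ω}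
    (hA : Pairwise (Function.onFun Disjoint A)) (s : Finset ι) :
    μ (s.sup A) = ∑ i ∈ s, μ (A i) := by
  classical
  induction s using Finset.induction_on with
  | empty => simpa using h.map_bot
  | insert i s hi ih =>
    rw [Finset.sup_insert, Finset.sum_insert hi, h, ih]
    rw [Finset.disjoint_sup_right]
    exact fun j hj => hA fun hij => hi (hij ▸ hj)

theorem IsCountablyAdditive.map_bot {μ : SigmaAlg Ω → ℝ} (h : IsCountablyAdditive μ) :
    μ ⊥ = 0 := by
  have := (h (fun _ => ⊥) fun _ _ _ => SigmaAlg.disjoint_coe.2 disjoint_bot_left).summable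
  exact tendsto_nhds_unique tendsto_const_nhds this.tendsto_atTop_zero

theorem IsCountablyAdditive.isFinitelyAdditive {μ : SigmaAlg Ω → ℝ}
    (h : IsCountablyAdditive μ) : IsFinitelyAdditive μ := by
  intro A B hAB
  let f : ℕ → SigmaAlg Ω := fun n => if n = 0 then A else if n = 1 then B else ⊥
  have hf : ∀ i j, i ≠ j → Disjoint (f i : Set Ω) (f j : Set Ω) := by
    intro i j hij
    rw [SigmaAlg.disjoint_coe]
    simp only [f]
    split_ifs <;> first | omega | exact hAB | simp [hAB.symm]
  have hU : (⟨⋃ n, (f n : Set Ω), MeasurableSet.iUnion fun n => (f n).2⟩ : SigmaAlg Ω)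
      = A ⊔ B := by
    apply Subtype.ext
    change (⋃ n, (f n : Set Ω)) = (A : Set Ω) ∪ B
    apply Set.Subset.antisymm
    · refine Set.iUnion_subset fun n => ?_
      simp only [f]
      split_ifs
      · exact Set.subset_union_left
      · exact Set.subset_union_right
      · exact Set.empty_subset _
    · exact Set.union_subset (Set.subset_iUnion (fun n => (f n : Set Ω)) 0)
        (Set.subset_iUnion (fun n => (f n : Set Ω)) 1)
  have h1 := h f hf
  rw [hU] at h1
  have h2 : HasSum (fun n => μ (f n)) (∑ n ∈ Finset.range 2, μ (f n)) := by
    apply hasSum_sum_of_ne_finset_zero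
    intro n hn
    have : f n = ⊥ := by
      simp only [f]
      rw [if_neg, if_neg] <;> simp at hn <;> omega
    rw [this, h.map_bot]
  simpa [Finset.sum_range_succ, f] using h1.unique h2

/-- A finitely additive map dominated, together with its negative, by countably additive maps is
countably additive. -/
theorem IsFinitelyAdditive.isCountablyAdditive_of_le {μ s t : SigmaAlg Ω → ℝ}
    (hμ : IsFinitelyAdditive μ) (hs : IsCountablyAdditive s) (ht : IsCountablyAdditive t)
    (h₁ : ∀ A, μ A ≤ s A) (h₂ : ∀ A, -t A ≤ μ A) : IsCountablyAdditive μ := by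
  intro A hA
  have hA' : Pairwise (Function.onFun Disjoint A) := fun i j hij =>
    SigmaAlg.disjoint_coe.1 (hA i j hij)
  set U : SigmaAlg Ω := ⟨⋃ n, (A n : Set Ω), MeasurableSet.iUnion fun n => (A n).2⟩ with hU
  have hle : ∀ F : Finset ℕ, F.sup A ≤ U := fun F =>
    Finset.sup_le fun n _ => Set.subset_iUnion (fun n => (A n : Set Ω)) n
  have key : ∀ {m : SigmaAlg Ω → ℝ}, IsFinitelyAdditive m → ∀ F : Finset ℕ,
      m (U \ F.sup A) = m U - ∑ n ∈ F, m (A n) := by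
    intro m hm F
    have := hm (F.sup A) (U \ F.sup A) disjoint_sdiff_self_right
    rw [sup_sdiff_cancel_right (hle F), hm.map_finset_sup hA'] at this
    linarith
  have lim : ∀ {m : SigmaAlg Ω → ℝ}, IsCountablyAdditive m →
      Tendsto (fun F : Finset ℕ => m (U \ F.sup A)) atTop (𝓝 0) := by
    intro m hm
    have h : Tendsto (fun F : Finset ℕ => ∑ n ∈ F, m (A n)) atTop (𝓝 (m U)) := hm A hA
    simpa [key hm.isFinitelyAdditive] using h.const_sub (m U)
  have hlim : Tendsto (fun F : Finset ℕ => μ (U \ F.sup A)) atTop (𝓝 0) :=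
    tendsto_of_tendsto_of_tendsto_of_le_of_le (by simpa using (lim ht).neg) (lim hs)
      (fun F => h₂ _) (fun F => h₁ _)
  have h : Tendsto (fun F : Finset ℕ => ∑ n ∈ F, μ (A n)) atTop (𝓝 (μ U)) := by
    simpa [key hμ] using hlim.const_sub (μ U)
  exact h

end Additive

/-! ### Gliding hump -/

/-- If the rows of a matrix are absolutely summable and the sums of the rows over every set of
columns tend to zero, then so does the diagonal. -/
theorem tendsto_diagonal_of_tendsto_tsum_indicator {a : ℕ → ℕ → ℝ}
    (ha : ∀ n, Summable (a n))
    (h : ∀ S : Set ℕ, Tendsto (fun n => ∑' k, S.indicator (a n) k) atTop (𝓝 0)) :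
    Tendsto (fun n => a n n) atTop (𝓝 0) := by
  by_contra hcon
  obtain ⟨ε, hε, hfreq⟩ : ∃ ε > 0, ∃ᶠ n in atTop, ε ≤ |a n n| := by
    simpa [Metric.tendsto_nhds, Real.dist_eq, frequently_atTop] using hcon
  have hcol : ∀ k, Tendsto (fun n => |a n k|) atTop (𝓝 0) := by
    intro k
    have h1 : ∀ n, ∑' j, ({k} : Set ℕ).indicator (a n) j = a n k := by
      intro n
      rw [tsum_eq_single k (fun j hj => by simp [hj])]
      simp
    simpa [h1] using (h {k}).abs
  have hstep : ∀ m, ∃ n > m, ε ≤ |a n n| ∧ ∑ k ∈ Finset.range (m + 1), |a n k| < ε / 4 ∧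
      ∑' k, |a m (k + n)| < ε / 4 := by
    intro m
    have h1 : ∀ᶠ n in atTop, ∑ k ∈ Finset.range (m + 1), |a n k| < ε / 4 := by
      have : Tendsto (fun n => ∑ k ∈ Finset.range (m + 1), |a n k|) atTop (𝓝 0) := by
        simpa using tendsto_finsetSum (Finset.range (m + 1)) fun k _ => hcol k
      exact this.eventually (gt_mem_nhds (by positivity))
    have h2 : ∀ᶠ n in atTop, ∑' k, |a m (k + n)| < ε / 4 :=
      (tendsto_sum_nat_add fun k => |a m k|).eventually (gt_mem_nhds (by positivity))
    obtain ⟨n, hn, h3, h4, h5⟩ :=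
      (hfreq.and_eventually (h1.and (h2.and (eventually_gt_atTop m)))).exists
    exact ⟨n, h5, hn, h3, h4⟩
  choose step hlt hbig hleft hright using hstep
  obtain ⟨g, hg⟩ : ∃ g : ℕ → ℕ, ∀ i, g (i + 1) = step (g i) :=
    ⟨fun i => step^[i] 0, fun i => Function.iterate_succ_apply' step i 0⟩
  have hmono : StrictMono g := strictMono_nat_of_lt_succ fun i => by rw [hg]; exact hlt _
  have hlow : ∀ i, ε / 2 ≤ |∑' k, (Set.range g).indicator (a (g (i + 1))) k| := by
    intro i
    set n := g (i + 1) with hn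
    set f := (Set.range g).indicator (a n) with hf
    have hfa : ∀ k, |f k| ≤ |a n k| := fun k => by
      by_cases hk : k ∈ Set.range g <;> simp [hf, hk]
    have hfs : Summable f := (ha n).indicator _
    have h1 : |∑ k ∈ Finset.range (g i + 1), f k| < ε / 4 := by
      refine (Finset.abs_sum_le_sum_abs _ _).trans_lt
        ((Finset.sum_le_sum fun k _ => hfa k).trans_lt ?_)
      rw [hn, hg]
      exact hleft _
    have h3 : |∑' k, f (k + g (i + 2))| < ε / 4 := by
      have s1 : Summable fun k => |a n (k + g (i + 2))| :=
        ((summable_nat_add_iff (g (i + 2))).2 (ha n)).abs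
      have s2 : Summable fun k => |f (k + g (i + 2))| :=
        ((summable_nat_add_iff (g (i + 2))).2 hfs).abs
      have h4 : |∑' k, f (k + g (i + 2))| ≤ ∑' k, |f (k + g (i + 2))| := by
        have s3 : Summable fun k => ‖f (k + g (i + 2))‖ := by simpa only [Real.norm_eq_abs] using s2
        simpa only [Real.norm_eq_abs] using norm_tsum_le_tsum_norm s3
      refine h4.trans_lt ((s2.tsum_le_tsum (fun k => hfa _) s1).trans_lt ?_)
      rw [hg (i + 1)]
      exact hright _
    have hi1 : g i + 1 ≤ g (i + 2) := hmono (by omega : i < i + 2)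
    have h2 : ∑ k ∈ Finset.Ico (g i + 1) (g (i + 2)), f k = a n n := by
      rw [Finset.sum_eq_single n]
      · simp [hf, hn]
      · intro k hk hkn
        rw [Finset.mem_Ico] at hk
        refine Set.indicator_of_notMem ?_ _
        rintro ⟨j, rfl⟩
        have h5 : i < j := hmono.lt_iff_lt.1 (by omega)
        have h6 : j < i + 2 := hmono.lt_iff_lt.1 hk.2
        exact hkn (by rw [hn]; congr 1; omega)
      · intro hnm
        refine absurd (Finset.mem_Ico.2 ⟨?_, ?_⟩) hnm
        · exact hmono (by omega : i < i + 1)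
        · exact hmono (by omega : i + 1 < i + 2)
    have hsum := hfs.sum_add_tsum_nat_add (g (i + 2))
    rw [← Finset.sum_range_add_sum_Ico _ hi1, h2] at hsum
    have hb : ε ≤ |a n n| := by rw [hn, hg]; exact hbig _
    rw [← hsum]
    grind
  have hlim := ((h (Set.range g)).comp (hmono.tendsto_atTop.comp (tendsto_add_atTop_nat 1))).abs
  rw [abs_zero] at hlim
  obtain ⟨i, hi⟩ := (hlim.eventually (gt_mem_nhds (half_pos hε))).exists
  exact absurd (hlow i) (not_le.2 hi)

/-! ### The Orlicz–Pettis theorem -/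

section OrliczPettis

variable {E : Type*} [AddCommGroup E] [Module ℝ E] [TopologicalSpace E]

/-- A continuous linear functional that is bounded above on a subspace vanishes there. -/
theorem ContinuousLinearMap.eq_zero_of_forall_mem_lt {W : Submodule ℝ E} {f : E →L[ℝ] ℝ} {u : ℝ}
    (h : ∀ w ∈ W, f w < u) {w : E} (hw : w ∈ W) : f w = 0 := by
  by_contra h0
  have := h _ (W.smul_mem (u / f w) hw)
  rw [map_smul, smul_eq_mul, div_mul_cancel₀ _ h0] at this
  exact lt_irrefl _ this

variable [IsTopologicalAddGroup E]

/-- The subspace on which an equicontinuous sequence of functionals tends to zero is closed. -/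
theorem exists_isClosed_submodule_tendsto_zero {p : Seminorm ℝ E} (hp : Continuous p)
    (ψ : ℕ → E →L[ℝ] ℝ) (hψ : ∀ n x, |ψ n x| ≤ p x) :
    ∃ W : Submodule ℝ E, IsClosed (W : Set E) ∧
      ∀ x, x ∈ W ↔ Tendsto (fun n => ψ n x) atTop (𝓝 0) := by
  let W : Submodule ℝ E :=
    { carrier := {x | Tendsto (fun n => ψ n x) atTop (𝓝 0)}
      zero_mem' := by simp
      add_mem' := fun {x y} hx hy => by
        simpa using Tendsto.add (show Tendsto (fun n => ψ n x) atTop (𝓝 0) from hx) hy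
      smul_mem' := fun c x hx => by
        simpa using Tendsto.const_mul c (show Tendsto (fun n => ψ n x) atTop (𝓝 0) from hx) }
  refine ⟨W, ?_, fun x => Iff.rfl⟩
  rw [← closure_subset_iff_isClosed]
  intro x hx
  change Tendsto (fun n => ψ n x) atTop (𝓝 0)
  rw [Metric.tendsto_nhds]
  intro ε hε
  have hopen : IsOpen {z | p (x - z) < ε / 2} :=
    isOpen_lt (hp.comp (continuous_const.sub continuous_id)) continuous_const
  obtain ⟨z, hz, hzW⟩ := mem_closure_iff.1 hx _ hopen (by simpa using half_pos hε)
  filter_upwards [(Metric.tendsto_nhds.1 (show Tendsto (fun n => ψ n z) atTop (𝓝 0) from hzW))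
    (ε / 2) (half_pos hε)] with n hn
  have h1 := (hψ n (x - z)).trans_lt hz
  rw [map_sub] at h1
  rw [Real.dist_eq, sub_zero] at hn ⊢
  grind

variable [ContinuousSMul ℝ E] [LocallyConvexSpace ℝ E]

theorem Seminorm.exists_dual_eq_of_continuous {p : Seminorm ℝ E} (hp : Continuous p) (x : E) :
    ∃ φ : E →L[ℝ] ℝ, φ x = p x ∧ ∀ y, |φ y| ≤ p y := by
  by_cases hx : x = 0
  · exact ⟨0, by simp [hx], fun y => by simp⟩
  let f : Module.Dual ℝ (Submodule.span ℝ {x}) :=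
    p x • (LinearEquiv.toSpanNonzeroSingleton ℝ E x hx).symm.toLinearMap
  have hf : ∀ c : ℝ, ∀ hc, f ⟨c • x, hc⟩ = p x * c := by
    intro c hc
    have : (LinearEquiv.toSpanNonzeroSingleton ℝ E x hx).symm ⟨c • x, hc⟩ = c := by
      rw [LinearEquiv.symm_apply_eq]
      rfl
    simp [f, this]
  obtain ⟨g, hg, hgp⟩ := Module.Dual.exists_continuous_extension_of_le_seminorm_real
    (Submodule.span ℝ {x}) f hp (by
      rintro ⟨y, hy⟩
      obtain ⟨c, rfl⟩ := Submodule.mem_span_singleton.1 hy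
      rw [hf, map_smul_eq_mul, mul_comm]
      exact mul_le_mul_of_nonneg_right (le_abs_self c) (apply_nonneg p x))
  refine ⟨g, ?_, hgp⟩
  have hx1 : (1 : ℝ) • x ∈ Submodule.span ℝ {x} :=
    Submodule.smul_mem _ _ (Submodule.mem_span_singleton_self x)
  have := hg ⟨(1 : ℝ) • x, hx1⟩
  rw [hf] at this
  simpa using this

/-- A sequential form of the Banach–Alaoglu theorem, for convergence on a sequence of points. -/
theorem exists_subseq_tendsto_dual {p : Seminorm ℝ E} (hp : Continuous p) (φ : ℕ → E →L[ℝ] ℝ)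
    (hφ : ∀ n x, |φ n x| ≤ p x) (x : ℕ → E) :
    ∃ (ψ : E →L[ℝ] ℝ) (h : ℕ → ℕ), StrictMono h ∧ (∀ y, |ψ y| ≤ p y) ∧
      ∀ k, Tendsto (fun n => φ (h n) (x k)) atTop (𝓝 (ψ (x k))) := by
  let U : Ultrafilter ℕ := Ultrafilter.of atTop
  have hU : (U : Filter ℕ) ≤ atTop := Ultrafilter.of_le _
  have hlim : ∀ y, ∃ l ∈ Set.Icc (-p y) (p y), Tendsto (fun n => φ n y) U (𝓝 l) := by
    intro y
    obtain ⟨l, hl, h⟩ := (isCompact_Icc (a := -p y) (b := p y)).ultrafilter_le_nhds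
      (U.map fun n => φ n y) (by
        rw [Ultrafilter.coe_map, le_principal_iff, mem_map]
        exact univ_mem' fun n => abs_le.1 (hφ n y))
    exact ⟨l, hl, h⟩
  choose l hl hlt using hlim
  let L : E →ₗ[ℝ] ℝ :=
    { toFun := l
      map_add' := fun y z => tendsto_nhds_unique (hlt (y + z)) (by
        simpa using (hlt y).add (hlt z))
      map_smul' := fun c y => tendsto_nhds_unique (hlt (c • y)) (by
        simpa using (hlt y).const_mul c) }
  let ψ : E →L[ℝ] ℝ := ⟨L, (PolynormableSpace.withSeminorms ℝ E).continuous_real_rng L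
    ⟨{⟨p, hp⟩}, 1, fun y => by simpa [L] using (hl y).2⟩⟩
  have hψ : ∀ y, ψ y = l y := fun y => rfl
  obtain ⟨h, hmono, hh⟩ := extraction_forall_of_frequently
    (P := fun N n => ∀ k ∈ Finset.range (N + 1), |φ n (x k) - ψ (x k)| < 1 / ((N : ℝ) + 1)) (by
      intro N
      have : ∀ᶠ n in (U : Filter ℕ),
          ∀ k ∈ Finset.range (N + 1), |φ n (x k) - ψ (x k)| < 1 / ((N : ℝ) + 1) := by
        rw [Finset.eventually_all]
        intro k _
        exact (Metric.tendsto_nhds.1 (hlt (x k))) _ (by positivity)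
      exact this.frequently.filter_mono hU)
  refine ⟨ψ, h, hmono, fun y => abs_le.2 (hl y), fun k => ?_⟩
  rw [tendsto_iff_dist_tendsto_zero]
  refine squeeze_zero' (Eventually.of_forall fun _ => dist_nonneg) ?_
    tendsto_one_div_add_atTop_nhds_zero_nat
  filter_upwards [eventually_ge_atTop k] with n hn
  exact (hh n k (Finset.mem_range.2 (by omega))).le

variable {Ω : Type*} [MeasurableSpace Ω]

theorem tendsto_seminorm_of_forall_dual_isCountablyAdditive {ν : SigmaAlg Ω → E}
    (hν : ∀ φ : E →L[ℝ] ℝ, IsCountablyAdditive fun A => φ (ν A))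
    {p : Seminorm ℝ E} (hp : Continuous p) {B : ℕ → SigmaAlg Ω}
    (hB : Pairwise (Function.onFun Disjoint B)) :
    Tendsto (fun n => p (ν (B n))) atTop (𝓝 0) := by
  classical
  by_contra hcon
  obtain ⟨ε, hε, hfreq⟩ : ∃ ε > 0, ∃ᶠ n in atTop, ε ≤ p (ν (B n)) := by
    simpa [Metric.tendsto_nhds, Real.dist_eq, abs_of_nonneg, frequently_atTop] using hcon
  obtain ⟨g, hg, hge⟩ := extraction_of_frequently_atTop hfreq
  choose φ hφ hφp using fun n => Seminorm.exists_dual_eq_of_continuous hp (ν (B (g n)))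
  obtain ⟨φ₀, h, hh, hφ₀, hlim⟩ := exists_subseq_tendsto_dual hp φ hφp fun n => ν (B (g n))
  let C : ℕ → SigmaAlg Ω := fun n => B (g (h n))
  have hC : Pairwise (Function.onFun Disjoint C) :=
    hB.comp_of_injective (hg.injective.comp hh.injective)
  let D : Set ℕ → ℕ → SigmaAlg Ω := fun S k => if k ∈ S then C k else ⊥
  let y : Set ℕ → E := fun S =>
    ν ⟨⋃ k, (D S k : Set Ω), MeasurableSet.iUnion fun k => (D S k).2⟩
  have hsum : ∀ (S : Set ℕ) (f : E →L[ℝ] ℝ),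
      HasSum (S.indicator fun k => f (ν (C k))) (f (y S)) := by
    intro S f
    have h1 := hν f (D S) (by
      intro i j hij
      rw [SigmaAlg.disjoint_coe]
      simp only [D]
      split_ifs <;> first | exact hC hij | simp)
    have h2 : (S.indicator fun k => f (ν (C k))) = fun k => f (ν (D S k)) := by
      funext k
      by_cases hk : k ∈ S
      · simp [D, hk]
      · simpa [D, hk] using (hν f).map_bot.symm
    rw [h2]
    exact h1
  have hsum' : ∀ f : E →L[ℝ] ℝ, Summable fun k => f (ν (C k)) := fun f => by
    simpa using (hsum Set.univ f).summable
  let ψ : ℕ → E →L[ℝ] ℝ := fun n => φ (h n) - φ₀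
  have hψ : ∀ n x, |ψ n x| ≤ (p + p) x := fun n x =>
    (abs_sub _ _).trans (add_le_add (hφp _ x) (hφ₀ x))
  obtain ⟨W, hWc, hW⟩ := exists_isClosed_submodule_tendsto_zero (p := p + p)
    (hp.add hp) ψ hψ
  have hCW : ∀ k, ν (C k) ∈ W := fun k => by
    rw [hW]
    simpa [ψ, C] using (hlim (h k)).sub_const (φ₀ (ν (C k)))
  have hyW : ∀ S, y S ∈ W := by
    intro S
    by_contra hy
    obtain ⟨f, u, hf, hu⟩ := geometric_hahn_banach_closed_point W.convex hWc hy
    have h0 : 0 < u := by simpa using hf 0 W.zero_mem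
    have h1 := hsum S f
    simp only [fun k => ContinuousLinearMap.eq_zero_of_forall_mem_lt hf (hCW k)] at h1
    simp only [Set.indicator_zero] at h1
    have := h1.unique hasSum_zero
    linarith
  have hdiag : Tendsto (fun n => ψ n (ν (C n))) atTop (𝓝 0) := by
    refine tendsto_diagonal_of_tendsto_tsum_indicator (a := fun n k => ψ n (ν (C k)))
      (fun n => hsum' (ψ n)) fun S => ?_
    simpa only [fun n => (hsum S (ψ n)).tsum_eq] using (hW _).1 (hyW S)
  have hzero := hdiag.add (hsum' φ₀).tendsto_atTop_zero
  simp only [ψ, sub_apply, sub_add_cancel, add_zero] at hzero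
  obtain ⟨n, hn⟩ := (hzero.eventually (gt_mem_nhds hε)).exists
  have := hge (h n)
  rw [← hφ] at this
  exact absurd this (not_le.2 hn)

/-- **Orlicz–Pettis theorem** in a locally convex space: a weakly countably additive map on a
σ-algebra is countably additive for the original topology. -/
theorem isCountablyAdditive_of_forall_dual [T2Space E] {ν : SigmaAlg Ω → E}
    (hν : ∀ φ : E →L[ℝ] ℝ, IsCountablyAdditive fun A => φ (ν A)) : IsCountablyAdditive ν := by
  classical
  have hadd : IsFinitelyAdditive ν := by
    intro A B hAB
    by_contra hne
    obtain ⟨f, hf⟩ := geometric_hahn_banach_point_point hne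
    rw [map_add] at hf
    exact hf.ne ((hν f).isFinitelyAdditive A B hAB)
  intro A hA
  have hA' : Pairwise (Function.onFun Disjoint A) := fun i j hij =>
    SigmaAlg.disjoint_coe.1 (hA i j hij)
  set U : SigmaAlg Ω := ⟨⋃ n, (A n : Set Ω), MeasurableSet.iUnion fun n => (A n).2⟩
  suffices Tendsto (fun F : Finset ℕ => ∑ n ∈ F, ν (A n)) atTop (𝓝 (ν U)) from this
  rw [(PolynormableSpace.withSeminorms ℝ E).tendsto_nhds]
  rintro ⟨p, hp⟩ ε hε
  change ∀ᶠ F : Finset ℕ in atTop, p (∑ n ∈ F, ν (A n) - ν U) < ε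
  by_contra hcon
  have hblock : ∀ F₀ : Finset ℕ, ∃ H : Finset ℕ, ε / 2 ≤ p (∑ n ∈ H, ν (A n)) ∧
      Disjoint F₀ H := by
    intro F₀
    rw [not_eventually] at hcon
    obtain ⟨F, hF₀, hF⟩ := frequently_atTop.1 hcon F₀
    rw [not_lt, map_sub_rev] at hF
    obtain ⟨φ, hφ, hφp⟩ := Seminorm.exists_dual_eq_of_continuous hp (ν U - ∑ n ∈ F, ν (A n))
    have hlim : Tendsto (fun G : Finset ℕ => ∑ n ∈ G, φ (ν (A n))) atTop (𝓝 (φ (ν U))) :=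
      hν φ A hA
    obtain ⟨G, hG, hFG⟩ := ((hlim.eventually (lt_mem_nhds (sub_lt_self _ (half_pos hε)))).and
      (eventually_ge_atTop F)).exists
    refine ⟨G \ F, ?_, Finset.disjoint_sdiff.mono_left hF₀⟩
    refine le_trans ?_ ((le_abs_self _).trans (hφp _))
    have h1 := Finset.sum_sdiff (f := fun n => φ (ν (A n))) hFG
    rw [map_sub, map_sum] at hφ
    rw [map_sum]
    linarith
  obtain ⟨H, hH, hHd⟩ := exists_seq_of_forall_finset_exists'
    (fun H : Finset ℕ => ε / 2 ≤ p (∑ n ∈ H, ν (A n))) Disjoint (by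
      intro s _
      obtain ⟨H, hH, hd⟩ := hblock (s.biUnion id)
      exact ⟨H, hH, fun x hx => hd.mono_left (Finset.subset_biUnion_of_mem id hx)⟩)
  have hB : Pairwise (Function.onFun Disjoint fun i => (H i).sup A) := by
    intro i j hij
    simp only [Function.onFun, Finset.disjoint_sup_left, Finset.disjoint_sup_right]
    intro m hm n hn
    exact hA' fun hmn => Finset.disjoint_left.1 (hHd hij) hn (hmn ▸ hm)
  have hlim := tendsto_seminorm_of_forall_dual_isCountablyAdditive hν hp hB
  obtain ⟨i, hi⟩ := (hlim.eventually (gt_mem_nhds (half_pos hε))).exists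
  rw [hadd.map_finset_sup hA'] at hi
  exact absurd (hH i) (not_le.2 hi)

end OrliczPettis

/-! ### Convex bodies -/

section ConvexBody

variable {E : Type*} [AddCommGroup E] [Module ℝ E] [TopologicalSpace E]

theorem le_supportValue (φ : E →L[ℝ] ℝ) {K : ConvexBody E} {x : E} (hx : x ∈ K) :
    φ x ≤ supportValue φ K :=
  (supportValue_isLUB φ K).1 ⟨x, hx, rfl⟩

theorem supportValue_add [ContinuousAdd E] (φ : E →L[ℝ] ℝ) (K L : ConvexBody E) :
    supportValue φ (K + L) = supportValue φ K + supportValue φ L := by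
  rw [supportValue, ConvexBody.coe_add, Set.image_add,
    csSup_add (K.nonempty.image φ) (supportValue_isLUB φ K).bddAbove (L.nonempty.image φ)
      (supportValue_isLUB φ L).bddAbove]
  rfl

theorem ConvexBody.le_of_forall_supportValue_le [IsTopologicalAddGroup E] [ContinuousSMul ℝ E]
    [LocallyConvexSpace ℝ E] [T2Space E] {K L : ConvexBody E}
    (h : ∀ φ : E →L[ℝ] ℝ, supportValue φ K ≤ supportValue φ L) : K ≤ L := by
  intro x hx
  by_contra hxL
  obtain ⟨f, u, hf, hu⟩ := geometric_hahn_banach_closed_point L.convex L.isClosed hxL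
  have h1 : supportValue f L ≤ u := (supportValue_isLUB f L).2 (by
    rintro _ ⟨y, hy, rfl⟩
    exact (hf y hy).le)
  linarith [le_supportValue f hx, h f]

theorem ConvexBody.eq_of_forall_supportValue_eq [IsTopologicalAddGroup E] [ContinuousSMul ℝ E]
    [LocallyConvexSpace ℝ E] [T2Space E] {K L : ConvexBody E}
    (h : ∀ φ : E →L[ℝ] ℝ, supportValue φ K = supportValue φ L) : K = L :=
  le_antisymm (le_of_forall_supportValue_le fun φ => (h φ).le)
    (le_of_forall_supportValue_le fun φ => (h φ).ge)

end ConvexBody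

section ExtremePoints

open scoped Pointwise

variable {E : Type*} [AddCommGroup E] [Module ℝ E]

theorem mem_extremePoints_left_of_add {K L : Set E} {a b : E} (ha : a ∈ K) (hb : b ∈ L)
    (h : a + b ∈ (K + L).extremePoints ℝ) : a ∈ K.extremePoints ℝ := by
  rw [mem_extremePoints_iff_left] at h ⊢
  refine ⟨ha, fun x hx y hy hxy => add_right_cancel (h.2 (x + b) (Set.add_mem_add hx hb) (y + b)
    (Set.add_mem_add hy hb) ?_)⟩
  obtain ⟨s, t, hs, ht, hst, rfl⟩ := hxy
  refine ⟨s, t, hs, ht, hst, ?_⟩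
  rw [smul_add, smul_add, add_add_add_comm, ← add_smul, hst, one_smul]

/-- An extreme point of `K + L` has a unique decomposition. -/
theorem eq_left_of_add_eq_of_mem_extremePoints {K L : Set E} {a b a' b' : E} (ha : a ∈ K) (hb : b ∈ L)
    (ha' : a' ∈ K) (hb' : b' ∈ L) (h : a + b ∈ (K + L).extremePoints ℝ)
    (heq : a' + b' = a + b) : a' = a := by
  have h1 : a' + b = a + b := by
    rw [mem_extremePoints_iff_left] at h
    refine h.2 (a' + b) (Set.add_mem_add ha' hb) (a + b') (Set.add_mem_add ha hb')
      ⟨1 / 2, 1 / 2, by norm_num, by norm_num, by norm_num, ?_⟩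
    rw [← smul_add, show a' + b + (a + b') = (a' + b') + (a + b) by abel, heq, ← two_smul ℝ,
      smul_smul]
    norm_num
  exact add_right_cancel h1

/-- A finitely additive set-valued map with convex compact values has a finitely additive selector
consisting of extreme points. -/
theorem IsFinitelyAdditive.exists_extremePoints_selector {Ω : Type*} [MeasurableSpace Ω]
    [TopologicalSpace E] [IsTopologicalAddGroup E] [ContinuousSMul ℝ E]
    [LocallyConvexSpace ℝ E] [T2Space E]
    {M : SigmaAlg Ω → ConvexBody E} (hM : IsFinitelyAdditive M) :
    ∃ ν : SigmaAlg Ω → E, IsFinitelyAdditive ν ∧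
      ∀ A, ν A ∈ Set.extremePoints ℝ (M A : Set E) := by
  obtain ⟨x, hx⟩ := (M ⊤).isCompact.extremePoints_nonempty (M ⊤).nonempty
  have hcompl : ∀ A, (M ⊤ : Set E) = (M A : Set E) + (M Aᶜ : Set E) := fun A => by
    rw [← ConvexBody.coe_add, ← hM A Aᶜ disjoint_compl_right, sup_compl_eq_top]
  have hdec : ∀ A, ∃ a ∈ M A, ∃ b ∈ M Aᶜ, a + b = x := fun A => by
    have := extremePoints_subset hx
    rwa [hcompl A] at this
  choose ν hν ρ hρ hx' using hdec
  have hext : ∀ A, ν A + ρ A ∈ ((M A : Set E) + (M Aᶜ : Set E)).extremePoints ℝ := fun A => by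
    rwa [hx', ← hcompl]
  have huniq : ∀ A, ∀ a ∈ M A, ∀ b ∈ M Aᶜ, a + b = x → ν A = a := fun A a ha b hb hab =>
    (eq_left_of_add_eq_of_mem_extremePoints (hν A) (hρ A) ha hb (hext A)
      (hab.trans (hx' A).symm)).symm
  refine ⟨ν, fun A B hAB => ?_,
    fun A => mem_extremePoints_left_of_add (hν A) (hρ A) (hext A)⟩
  have hmem : ν (A ⊔ B) ∈ (M A : Set E) + (M B : Set E) := by
    rw [← ConvexBody.coe_add, ← hM A B hAB]
    exact hν _
  obtain ⟨a, ha, b, hb, hab⟩ := hmem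
  have hsum : a + b + ρ (A ⊔ B) = x := by rw [show a + b = ν (A ⊔ B) from hab, hx']
  have hrest : ∀ {A B : SigmaAlg Ω}, Disjoint A B → ∀ {b c}, b ∈ M B → c ∈ M (A ⊔ B)ᶜ →
      b + c ∈ M Aᶜ := by
    intro A B hAB b c hb hc
    have h1 : Aᶜ = B ⊔ (A ⊔ B)ᶜ := by
      rw [compl_sup, sup_inf_left, sup_compl_eq_top, inf_top_eq,
        sup_eq_right.2 hAB.symm.le_compl_right]
    have h2 : M Aᶜ = M B + M (A ⊔ B)ᶜ := by
      conv_lhs => rw [h1]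
      exact hM _ _ (disjoint_compl_right.mono_left le_sup_right)
    rw [h2]
    exact Set.add_mem_add hb hc
  have hA : ν A = a := huniq A a ha _ (hrest hAB hb (hρ (A ⊔ B))) (by rw [← hsum, add_assoc])
  have hB : ν B = b := by
    refine huniq B b hb (a + ρ (A ⊔ B)) (hrest hAB.symm ha ?_) (by rw [← hsum]; abel)
    rw [sup_comm B A]
    exact hρ _
  rw [hA, hB]
  exact hab.symm

end ExtremePoints

theorem theorem5p1 {Ω : Type*} [MeasurableSpace Ω]
    {E : Type*} [AddCommGroup E] [Module ℝ E] [TopologicalSpace E] [IsTopologicalAddGroup E]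
    [ContinuousSMul ℝ E] [LocallyConvexSpace ℝ E] [T2Space E]
    (M : SigmaAlg Ω → ConvexBody E)
    (hM : ∀ φ : E →L[ℝ] ℝ, IsCountablyAdditive (supportMap φ M)) :
    ∃ ν : SigmaAlg Ω → E, IsCountablyAdditive ν ∧
      ∀ A : SigmaAlg Ω, ν A ∈ Set.extremePoints ℝ (M A : Set E) := by
  have hMadd : IsFinitelyAdditive M := fun A B hAB =>
    ConvexBody.eq_of_forall_supportValue_eq fun φ => by
      rw [supportValue_add]
      exact (hM φ).isFinitelyAdditive A B hAB
  obtain ⟨ν, hν, hext⟩ := hMadd.exists_extremePoints_selector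
  refine ⟨ν, isCountablyAdditive_of_forall_dual fun φ => ?_, hext⟩
  refine IsFinitelyAdditive.isCountablyAdditive_of_le (s := supportMap φ M)
    (t := supportMap (-φ) M) (fun A B hAB => ?_) (hM φ) (hM (-φ))
    (fun A => le_supportValue φ (extremePoints_subset (hext A))) fun A => ?_
  · rw [hν A B hAB, map_add]
  · have h := le_supportValue (-φ) (extremePoints_subset (hext A))
    rw [neg_apply] at h
    exact neg_le.1 h
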